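/- A partition is identified with its Ferrers diagram, and $|\lambda|$ denotes the number of its boxes. The hook of a box $v$ consists of $v$, the boxes to the right of $v$ in its row of the diagram and the boxes after $v$ in its column; the hook length of $v$ is the number of boxes of its hook, and it is called principal if $v$ lies on the diagonal. A partition is an $m$-core if none of its hook lengths is a multiple of $m$. The doubled distinct partition of a partition $\mu^0$ with distinct parts $\mu^0_1>\dots>\mu^0_\ell>0$ is obtained from the Ferrers diagram of $\mu^0$ by shifting the $i$-th row by $i$ boxes to the right and then adding $\mu^0_i$ boxes to the $i$-th column, for all $1\le i\le \ell$. Let $SC_{(m)}$ be the set of self-conjugate $m$-cores and $DD_{(m)}$ the set of $m$-cores that are doubled distinct partitions (the empty partition belongs to both). Let $t\ge 2$ be an integer. For $(\lambda,\mu)\in SC_{(t+1)}\times DD_{(t+1)}$, let $\Delta$ be the set of all principal hook lengths of $\lambda$ and of $\mu$, and for $1\le i\le t$ put $$\Delta_i:=\max\bigl(\{h\in\Delta : h\equiv \pm i-t-1 \bmod (2t+2)\}\cup\{i-t-1\}\bigr).$$ **Theorem.** There is a bijection $\varphi\colon SC_{(t+1)}\times DD_{(t+1)}\to\mathbb Z^t$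 such that, for every $(\lambda,\mu)\in SC_{(t+1)}\times DD_{(t+1)}$ with $\varphi(\lambda,\mu)=(n_1,\dots,n_t)$, $$|\lambda|+|\mu|=(t+1)\sum_{i=1}^t n_i^2+\sum_{i=1}^t i\,n_i ,$$ and, for all $i\in\{1,\dots,t\}$, $$t+1+\Delta_i=\sigma_i\bigl((2t+2)n_i+i\bigr),$$ where $\sigma_i=1$ if $n_i\ge 0$ and $\sigma_i=-1$ if $n_i<0$. -/

import Mathlib

namespace YoungDiagram

/- A partition is identified with its Ferrers diagram: a box `(i, j)` (row `i`, column `j`, both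
counted from `0`) belongs to the diagram when `j` is smaller than the `i`-th part. -/

/-- The hook of the box `v`: the boxes of the row of `v` that are not before `v`, and the boxes of
the column of `v` that are not before `v` (the box `v` itself is counted once). -/
def hook (la : YoungDiagram) (v : ℕ × ℕ) : Finset (ℕ × ℕ) :=
  la.cells.filter (fun u => (u.1 = v.1 ∧ v.2 ≤ u.2) ∨ (u.2 = v.2 ∧ v.1 ≤ u.1))

/-- The hook length of the box `v`. -/
def hookLength (la : YoungDiagram) (v : ℕ × ℕ) : ℕ := (la.hook v).card

/-- `la` is an `m`-core: none of its hook lengths is a multiple of `m`. -/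
def IsCore (m : ℕ) (la : YoungDiagram) : Prop := ∀ v ∈ la, ¬ m ∣ la.hookLength v

/-- The parts of `nu` (its nonzero row lengths) are pairwise distinct. -/
def HasDistinctParts (nu : YoungDiagram) : Prop := nu.rowLens.Nodup

/-- The shifted Ferrers diagram of `nu`: with rows and columns counted from `1`, the `i`-th row is
shifted by `i` to the right; with rows counted from `0`, row `i` is shifted by `i + 1`. -/
def shiftedCells (nu : YoungDiagram) : Finset (ℕ × ℕ) :=
  nu.cells.image (fun c => (c.1, c.2 + (c.1 + 1)))

/-- The boxes added to the shifted diagram: as many boxes in column `i` as there are boxes in row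
`i` of `nu`. Column `i` of the shifted diagram occupies the rows `0, …, i - 1` when row `i` of `nu`
is not empty, so the new boxes start in row `i`. -/
def addedCells (nu : YoungDiagram) : Finset (ℕ × ℕ) :=
  nu.cells.image (fun c => (c.2 + c.1, c.1))

theorem HasDistinctParts.rowLen_lt {nu : YoungDiagram} (h : nu.HasDistinctParts) {i k : ℕ}
    (hik : i < k) (hi : 0 < nu.rowLen i) : nu.rowLen k < nu.rowLen i := by
  have hle := nu.rowLen_anti i k hik.le
  rcases Nat.eq_zero_or_pos (nu.rowLen k) with h0 | hk
  · omega
  have li : i < nu.colLen 0 := mem_iff_lt_colLen.1 (mem_iff_lt_rowLen.2 hi)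
  have lk : k < nu.colLen 0 := mem_iff_lt_colLen.1 (mem_iff_lt_rowLen.2 hk)
  rw [← length_rowLens] at li lk
  refine lt_of_le_of_ne hle fun he => ?_
  have : nu.rowLens[k] = nu.rowLens[i] := by simpa [get_rowLens] using he
  exact absurd ((List.Nodup.getElem_inj_iff h).1 this) (by omega)

theorem HasDistinctParts.rowLen_add_le {nu : YoungDiagram} (h : nu.HasDistinctParts) {i k : ℕ}
    (hik : i ≤ k) (hk : 0 < nu.rowLen k) : nu.rowLen k + k ≤ nu.rowLen i + i := by
  induction k, hik using Nat.le_induction with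
  | base => rfl
  | succ k hik ih =>
    have h1 := nu.rowLen_anti k (k + 1) (by omega)
    have h2 := h.rowLen_lt (show k < k + 1 by omega) (by omega)
    have h3 := ih (by omega)
    omega

theorem mem_shifted_union_added {nu : YoungDiagram} {a b : ℕ} :
    (a, b) ∈ nu.shiftedCells ∪ nu.addedCells ↔
      (a < b ∧ b < nu.rowLen a + (a + 1)) ∨ (b ≤ a ∧ a < nu.rowLen b + b) := by
  simp only [shiftedCells, addedCells, Finset.mem_union, Finset.mem_image, mem_cells, Prod.exists,
    Prod.mk.injEq, mem_iff_lt_rowLen]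
  constructor
  · rintro (⟨x, y, hy, rfl, rfl⟩ | ⟨x, y, hy, rfl, rfl⟩)
    · left; omega
    · right; omega
  · rintro (⟨h1, h2⟩ | ⟨h1, h2⟩)
    · exact Or.inl ⟨a, b - (a + 1), by omega, rfl, by omega⟩
    · exact Or.inr ⟨b, a - b, by omega, by omega, rfl⟩

/-- The doubled distinct partition of a partition with distinct parts. -/
def doubled (nu : YoungDiagram) (h : nu.HasDistinctParts) : YoungDiagram where
  cells := nu.shiftedCells ∪ nu.addedCells
  isLowerSet := by
    rintro ⟨a, b⟩ ⟨c, d⟩ hle hab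
    obtain ⟨hca, hdb⟩ : c ≤ a ∧ d ≤ b := hle
    rw [Finset.mem_coe, mem_shifted_union_added] at hab ⊢
    rcases hab with ⟨h1, h2⟩ | ⟨h1, h2⟩
    · have k1 := h.rowLen_add_le hca (by omega)
      rcases Nat.lt_or_ge c d with hcd | hcd
      · left; omega
      · right
        have k2 := h.rowLen_add_le (i := d) (k := a) (by omega) (by omega)
        omega
    · rcases Nat.lt_or_ge c d with hcd | hcd
      · left
        have k2 := h.rowLen_add_le (i := c) (k := b) (by omega) (by omega)
        omega
      · right
        have k2 := h.rowLen_add_le hdb (by omega)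
        omega

/-- The set of self-conjugate `m`-cores. -/
def selfConjugateCores (m : ℕ) : Set YoungDiagram :=
  {la | la.transpose = la ∧ la.IsCore m}

/-- The set of doubled distinct partitions. -/
def doubledDistinct : Set YoungDiagram :=
  {mu | ∃ (nu : YoungDiagram) (h : nu.HasDistinctParts), nu.doubled h = mu}

/-- The set of doubled distinct `m`-cores. -/
def doubledDistinctCores (m : ℕ) : Set YoungDiagram :=
  {mu | mu ∈ doubledDistinct ∧ mu.IsCore m}

/-- The set of principal hook lengths: the hook lengths of the boxes on the diagonal. -/
def principalHookLengths (la : YoungDiagram) : Finset ℕ :=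
  (la.cells.filter (fun v => v.1 = v.2)).image la.hookLength

/-- The principal hook lengths `h` of `la` and `mu` with `h ≡ ± i - t - 1` modulo `2 t + 2`,
together with `i - t - 1`. -/
def hookClass (t : ℕ) (la mu : YoungDiagram) (i : ℕ) : Finset ℤ :=
  insert ((i : ℤ) - t - 1)
    (((la.principalHookLengths ∪ mu.principalHookLengths).image (fun h : ℕ => (h : ℤ))).filter
      (fun h => h ≡ (i : ℤ) - t - 1 [ZMOD 2 * t + 2] ∨ h ≡ -(i : ℤ) - t - 1 [ZMOD 2 * t + 2]))

/-- The number `Δ_i` of the pair `(la, mu)`. -/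
def maxHook (t : ℕ) (la mu : YoungDiagram) (i : ℕ) : ℤ :=
  (hookClass t la mu i).max' (Finset.insert_nonempty _ _)

end YoungDiagram

/-- The sign with the convention that the sign of `0` is `1`. -/
def signOf (n : ℤ) : ℤ := if 0 ≤ n then 1 else -1

/-! Encode a diagram by its beta set `X`, the numbers `rowLen i - i - 1`. The complement of `X`
consists of the numbers `j - colLen j`, and the hook length of `(i, j)` is the difference of the
two. Hence being an `m`-core means that `X` is closed under `x ↦ x - m`. Self-conjugacy is the
symmetry "exactly one of `x`, `-1 - x` lies in `X`", and principal hook lengths are then `2 * x + 1`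
for `0 ≤ x ∈ X`. For doubled distinct diagrams the reflection is `x ↦ -x` with `0 ∉ X`, and the
principal hook lengths are `2 * x`.

So a pair merges into one set `T`, odd part from `la`, even part from `mu`: it omits `0`, contains
exactly one of `±z` for `z ≠ 0`, is closed under subtracting `2 * m`, and its nonnegative elements
are exactly `Δ`. With `m = t + 1`, write integers as `2 * m * q + r - m`. In each residue class `T`
is an initial ray of quotients `q`; the classes `r = 0` and `r = m` are forced, and `-r` is
determined by `r`. The free data are the largest quotients `n_i` for `r = i`, `1 ≤ i ≤ t`, and every
choice occurs (`isSymmetricCoreSet_thresholdSet`, `exists_pairSet_eq`).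

By `nonneg_mem_iff_exists_residuePart`, `Δ` is the disjoint union over `i` of the numbers `2 * m * q
+ i - m`, `1 ≤ q ≤ n_i`, or `2 * m * q - i - m`, `1 ≤ q ≤ -n_i`. Each progression sums to `m * n_i ^
2 + i * n_i`, its maximum gives `Δ_i`, and the principal hooks partition each diagram. -/

namespace YoungDiagram

/-! ### Beta sets, hook lengths and cores -/

/-- The set of numbers `rowLen i - i - 1`, `i = 0, 1, 2, …`, of a diagram. -/
def betaSet (la : YoungDiagram) : Set ℤ := {x | ∃ i : ℕ, (la.rowLen i : ℤ) - i - 1 = x}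

theorem lt_rowLen_iff_lt_colLen (la : YoungDiagram) {i j : ℕ} :
    j < la.rowLen i ↔ i < la.colLen j :=
  mem_iff_lt_rowLen.symm.trans mem_iff_lt_colLen

theorem notMem_betaSet_iff {la : YoungDiagram} {x : ℤ} :
    x ∉ la.betaSet ↔ ∃ j : ℕ, (j : ℤ) - la.colLen j = x := by
  constructor
  · intro hx
    have hex : ∃ i : ℕ, (la.rowLen i : ℤ) - i - 1 ≤ x := by
      refine ⟨la.rowLen 0 + x.natAbs, ?_⟩
      have := la.rowLen_anti 0 (la.rowLen 0 + x.natAbs) (by omega)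
      omega
    classical
    obtain ⟨i, hi, hmin⟩ := Nat.findX hex
    have hlt : (la.rowLen i : ℤ) - i - 1 < x := lt_of_le_of_ne hi fun h => hx ⟨i, h⟩
    -- Exactly the rows before `i` have value above `x`, so column `x + i` has length `i`.
    refine ⟨(x + i).toNat, ?_⟩
    have h1 : ¬ i < la.colLen (x + i).toNat := by
      rw [← lt_rowLen_iff_lt_colLen]; omega
    rcases Nat.eq_zero_or_pos i with rfl | hpos
    · omega
    · have h2 := hmin (i - 1) (by omega)
      have h3 : i - 1 < la.colLen (x + i).toNat := by
        rw [← lt_rowLen_iff_lt_colLen]; omega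
      omega
  · rintro ⟨j, rfl⟩ ⟨i, hi⟩
    have := la.lt_rowLen_iff_lt_colLen (i := i) (j := j)
    omega

/-- The row values strictly decrease, so the set determines the sequence; signs are reversed below
to get a strictly increasing one. -/
theorem betaSet_injective : Function.Injective betaSet := by
  intro la mu h
  have hmono : ∀ nu : YoungDiagram, StrictMono fun i : ℕ => (i : ℤ) + 1 - nu.rowLen i := by
    intro nu
    refine strictMono_nat_of_lt_succ fun i => ?_
    have := nu.rowLen_anti i (i + 1) (by omega)
    push_cast
    omega
  have hr : (fun i : ℕ => (i : ℤ) + 1 - la.rowLen i) = fun i : ℕ => (i : ℤ) + 1 - mu.rowLen i := by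
    refine ((hmono la).range_inj (hmono mu)).1 (Set.ext fun x => ?_)
    have hx : -x ∈ la.betaSet ↔ -x ∈ mu.betaSet := by rw [h]
    constructor
    · rintro ⟨i, rfl⟩
      obtain ⟨k, hk⟩ := hx.1 ⟨i, by ring⟩
      exact ⟨k, by simp only at hk ⊢; omega⟩
    · rintro ⟨i, rfl⟩
      obtain ⟨k, hk⟩ := hx.2 ⟨i, by ring⟩
      exact ⟨k, by simp only at hk ⊢; omega⟩
  refine YoungDiagram.ext (Finset.ext fun ⟨i, j⟩ => ?_)
  have hi := congrFun hr i
  rw [mem_cells, mem_cells, mem_iff_lt_rowLen, mem_iff_lt_rowLen]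
  omega

theorem hookLength_add (la : YoungDiagram) {i j : ℕ} (h : (i, j) ∈ la) :
    la.hookLength (i, j) + i + j + 1 = la.rowLen i + la.colLen j := by
  have h1 := mem_iff_lt_rowLen.1 h
  have h2 := mem_iff_lt_colLen.1 h
  have hd : la.hook (i, j) = (Finset.Ico j (la.rowLen i)).image (fun k => (i, k)) ∪
      (Finset.Ico (i + 1) (la.colLen j)).image (fun k => (k, j)) := by
    ext ⟨a, b⟩
    simp only [hook, Finset.mem_filter, mem_cells, Finset.mem_union, Finset.mem_image,
      Finset.mem_Ico, Prod.mk.injEq]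
    constructor
    · rintro ⟨hm, ⟨rfl, hb⟩ | ⟨rfl, ha⟩⟩
      · exact Or.inl ⟨b, ⟨hb, mem_iff_lt_rowLen.1 hm⟩, rfl, rfl⟩
      · rcases ha.eq_or_lt with rfl | ha
        · exact Or.inl ⟨b, ⟨le_rfl, h1⟩, rfl, rfl⟩
        · exact Or.inr ⟨a, ⟨ha, mem_iff_lt_colLen.1 hm⟩, rfl, rfl⟩
    · rintro (⟨k, ⟨hk, hk'⟩, rfl, rfl⟩ | ⟨k, ⟨hk, hk'⟩, rfl, rfl⟩)
      · exact ⟨mem_iff_lt_rowLen.2 hk', Or.inl ⟨rfl, hk⟩⟩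
      · exact ⟨mem_iff_lt_colLen.2 hk', Or.inr ⟨rfl, by omega⟩⟩
  have hdisj : Disjoint ((Finset.Ico j (la.rowLen i)).image (fun k => (i, k)))
      ((Finset.Ico (i + 1) (la.colLen j)).image (fun k => (k, j))) := by
    rw [Finset.disjoint_left]
    simp only [Finset.mem_image, Finset.mem_Ico, not_exists, not_and]
    rintro _ ⟨k, -, rfl⟩ l hl he
    have := congrArg Prod.fst he
    simp only at this
    omega
  rw [hookLength, hd, Finset.card_union_of_disjoint hdisj,
    Finset.card_image_of_injective _ (fun a b hab => congrArg Prod.snd hab),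
    Finset.card_image_of_injective _ (fun a b hab => congrArg Prod.fst hab),
    Nat.card_Ico, Nat.card_Ico]
  omega

/-- A hook length is an element of the beta set minus a non-element. An `x` whose shift `x - m` is
missing yields a hook of length exactly `m`; a hook of length `m * k` contradicts closure iterated
`k` times. -/
theorem isCore_iff {m : ℕ} (hm : 0 < m) {la : YoungDiagram} :
    la.IsCore m ↔ ∀ x ∈ la.betaSet, x - m ∈ la.betaSet := by
  constructor
  · rintro h _ ⟨i, rfl⟩
    by_contra hx
    obtain ⟨j, hj⟩ := notMem_betaSet_iff.1 hx
    have hiff := la.lt_rowLen_iff_lt_colLen (i := i) (j := j)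
    have hmem : (i, j) ∈ la := mem_iff_lt_rowLen.2 (by omega)
    have := la.hookLength_add hmem
    exact h _ hmem ⟨1, by omega⟩
  · rintro h ⟨i, j⟩ hmem ⟨k, hk⟩
    have hb : ∀ k : ℕ, (la.rowLen i : ℤ) - i - 1 - m * k ∈ la.betaSet := by
      intro k
      induction k with
      | zero => exact ⟨i, by simp⟩
      | succ k ih =>
        have := h _ ih
        convert this using 1
        push_cast
        ring
    have hadd := la.hookLength_add hmem
    rw [hk] at hadd
    refine notMem_betaSet_iff.2 ⟨j, ?_⟩ (hb k)
    zify at hadd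
    linarith

theorem betaSet_lt (la : YoungDiagram) {x : ℤ} (hx : x ∈ la.betaSet) : x < la.rowLen 0 := by
  obtain ⟨i, rfl⟩ := hx
  have := la.rowLen_anti 0 i (by omega)
  omega

/-! ### Principal hooks and the two symmetry types -/

/-- The boxes on the diagonal index hooks that partition the diagram. -/
theorem card_eq_sum_principal (la : YoungDiagram) :
    la.card = ∑ h ∈ la.principalHookLengths, h := by
  -- `principalHookLengths` is a set, so the sum loses nothing only because hook lengths strictly
  -- decrease along the diagonal.
  have hinj : Set.InjOn la.hookLength ↑(la.cells.filter (fun v => v.1 = v.2)) := by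
    have key : ∀ a b : ℕ, (a, a) ∈ la → (b, b) ∈ la → a < b →
        la.hookLength (b, b) < la.hookLength (a, a) := by
      intro a b ha hb hab
      have h1 := la.hookLength_add ha
      have h2 := la.hookLength_add hb
      have h3 := la.rowLen_anti a b hab.le
      have h4 := la.colLen_anti a b hab.le
      omega
    rintro ⟨a, a'⟩ ha ⟨b, b'⟩ hb hab
    simp only [Finset.coe_filter, Set.mem_ofPred_eq, mem_cells] at ha hb
    obtain ⟨ha, rfl⟩ := ha
    obtain ⟨hb, rfl⟩ := hb
    rcases lt_trichotomy a b with h | rfl | h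
    · have := key a b ha hb h
      omega
    · rfl
    · have := key b a hb ha h
      omega
  rw [principalHookLengths, Finset.sum_image hinj, YoungDiagram.card,
    Finset.card_eq_sum_card_fiberwise (f := fun u : ℕ × ℕ => (min u.1 u.2, min u.1 u.2))
      (t := la.cells.filter (fun v => v.1 = v.2))]
  · refine Finset.sum_congr rfl fun v hv => ?_
    rw [hookLength, hook]
    congr 1
    ext ⟨a, b⟩
    obtain ⟨c, d⟩ := v
    simp only [Finset.mem_filter, mem_cells, Prod.mk.injEq] at hv ⊢
    refine and_congr_right fun _ => ?_
    omega
  · rintro ⟨a, b⟩ hu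
    simp only [Finset.coe_filter, Set.mem_ofPred_eq, mem_cells, and_true]
    exact la.up_left_mem (min_le_left a b) (min_le_right a b) hu

theorem betaSet_symm_of_transpose_eq {la : YoungDiagram} (h : la.transpose = la) (x : ℤ) :
    x ∈ la.betaSet ↔ -1 - x ∉ la.betaSet := by
  have hc : ∀ i, la.colLen i = la.rowLen i := fun i => by
    rw [← YoungDiagram.rowLen_transpose, h]
  rw [notMem_betaSet_iff]
  constructor
  · rintro ⟨i, rfl⟩
    exact ⟨i, by rw [hc]; ring⟩
  · rintro ⟨i, hi⟩
    exact ⟨i, by rw [hc] at hi; omega⟩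

theorem mem_principal_of_transpose_eq {la : YoungDiagram} (h : la.transpose = la) (k : ℕ) :
    k ∈ la.principalHookLengths ↔ ∃ x : ℤ, 0 ≤ x ∧ x ∈ la.betaSet ∧ (k : ℤ) = 2 * x + 1 := by
  have hc : ∀ i, la.colLen i = la.rowLen i := fun i => by
    rw [← YoungDiagram.rowLen_transpose, h]
  simp only [principalHookLengths, Finset.mem_image, Finset.mem_filter, mem_cells]
  constructor
  · rintro ⟨⟨i, j⟩, ⟨hm, hij⟩, rfl⟩
    obtain rfl : i = j := hij
    have h1 := la.hookLength_add hm
    have h2 := mem_iff_lt_rowLen.1 hm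
    rw [hc] at h1
    exact ⟨_, by omega, ⟨i, rfl⟩, by omega⟩
  · rintro ⟨_, hx, ⟨i, rfl⟩, hk⟩
    have hm : (i, i) ∈ la := mem_iff_lt_rowLen.2 (by omega)
    have h1 := la.hookLength_add hm
    rw [hc] at h1
    exact ⟨(i, i), ⟨hm, rfl⟩, by omega⟩

/-- The boxes strictly above the diagonal are the shifted copy of `nu`, and the added boxes are
their mirror images under `(a, c + 1) ↦ (c, a)`. Conversely `nu` is read off from the boxes strictly
above the diagonal. -/
theorem mem_doubledDistinct_iff {mu : YoungDiagram} :
    mu ∈ doubledDistinct ↔ ∀ a c : ℕ, a ≤ c → ((a, c + 1) ∈ mu ↔ (c, a) ∈ mu) := by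
  constructor
  · rintro ⟨nu, h, rfl⟩ a c hac
    rw [← mem_cells, ← mem_cells]
    change _ ∈ nu.shiftedCells ∪ nu.addedCells ↔ _ ∈ nu.shiftedCells ∪ nu.addedCells
    rw [mem_shifted_union_added, mem_shifted_union_added]
    omega
  · intro h
    have hinj : Function.Injective fun c : ℕ × ℕ => (c.1, c.1 + 1 + c.2) := by
      rintro ⟨a, b⟩ ⟨c, d⟩ hab
      simp only [Prod.mk.injEq] at hab ⊢
      omega
    obtain ⟨S, hS⟩ : ∃ S : Finset (ℕ × ℕ), ∀ a b, (a, b) ∈ S ↔ (a, a + 1 + b) ∈ mu :=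
      ⟨mu.cells.preimage (fun c : ℕ × ℕ => (c.1, c.1 + 1 + c.2)) hinj.injOn,
        fun a b => by rw [Finset.mem_preimage, mem_cells]⟩
    let nu : YoungDiagram :=
      { cells := S
        isLowerSet := by
          rintro ⟨a, b⟩ ⟨c, d⟩ hle hab
          obtain ⟨hca, hdb⟩ : c ≤ a ∧ d ≤ b := hle
          rw [Finset.mem_coe, hS] at hab ⊢
          exact mu.up_left_mem hca (by omega) hab }
    have hrow : ∀ i j, j < nu.rowLen i ↔ i + 1 + j < mu.rowLen i := fun i j => by
      rw [← mem_iff_lt_rowLen, ← mem_iff_lt_rowLen]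
      exact hS i j
    have hrow' : ∀ i, nu.rowLen i = mu.rowLen i - (i + 1) := fun i => by
      have h1 := hrow i (nu.rowLen i)
      have h2 := hrow i (nu.rowLen i - 1)
      omega
    have hd : nu.HasDistinctParts := by
      rw [HasDistinctParts, List.nodup_iff_injective_getElem]
      have key : ∀ a b : ℕ, a < b → b < nu.rowLens.length → nu.rowLen b < nu.rowLen a := by
        intro a b hab hb
        rw [length_rowLens, ← lt_rowLen_iff_lt_colLen] at hb
        have := mu.rowLen_anti a b hab.le
        have := hrow' a
        have := hrow' b
        omega
      rintro ⟨a, ha⟩ ⟨b, hb⟩ hab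
      simp only [get_rowLens] at hab
      rw [Fin.mk.injEq]
      rcases lt_trichotomy a b with h | h | h
      · have := key a b h hb
        omega
      · exact h
      · have := key b a h ha
        omega
    refine ⟨nu, hd, YoungDiagram.ext (Finset.ext fun ⟨a, b⟩ => ?_)⟩
    change _ ∈ nu.shiftedCells ∪ nu.addedCells ↔ _
    rw [mem_shifted_union_added, mem_cells, hrow', hrow']
    rcases Nat.lt_or_ge a b with hab | hab
    · rw [mem_iff_lt_rowLen]
      omega
    · rw [← h b a hab, mem_iff_lt_rowLen]
      omega

theorem colLen_of_doubled {mu : YoungDiagram} (h : mu ∈ doubledDistinct) {k : ℕ}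
    (hk : (k, k) ∈ mu) : mu.colLen k + 1 = mu.rowLen k := by
  rw [mem_doubledDistinct_iff] at h
  have hk' := mem_iff_lt_colLen.1 hk
  have h1 := h k (mu.colLen k) hk'.le
  have h2 := h k (mu.colLen k - 1) (by omega)
  simp only [mem_iff_lt_rowLen (i := k), mem_iff_lt_colLen (j := k)] at h1 h2
  omega

theorem betaSet_symm_of_doubled {mu : YoungDiagram} (h : mu ∈ doubledDistinct) :
    0 ∉ mu.betaSet ∧ ∀ x : ℤ, x ≠ 0 → (x ∈ mu.betaSet ↔ -x ∉ mu.betaSet) := by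
  have h1 : ∀ x : ℤ, 0 ≤ x → x ∈ mu.betaSet → -x ∉ mu.betaSet := by
    rintro _ hx ⟨i, rfl⟩
    have := colLen_of_doubled h (k := i) (mem_iff_lt_rowLen.2 (by omega))
    exact notMem_betaSet_iff.2 ⟨i, by omega⟩
  have h2 : ∀ x : ℤ, 0 < x → x ∉ mu.betaSet → -x ∈ mu.betaSet := by
    intro x hx hmem
    obtain ⟨j, rfl⟩ := notMem_betaSet_iff.1 hmem
    rw [mem_doubledDistinct_iff] at h
    -- Below the diagonal, row `j - 1` mirrors column `j`, so it has length `colLen j` and its value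
    -- is `colLen j - j`.
    refine ⟨j - 1, ?_⟩
    have h3 := h (mu.colLen j) (j - 1) (by omega)
    have h4 := h (mu.colLen j - 1) (j - 1) (by omega)
    rw [Nat.sub_add_cancel (by omega)] at h3 h4
    simp only [mem_iff_lt_rowLen (i := j - 1), mem_iff_lt_colLen (j := j)] at h3 h4
    omega
  refine ⟨fun h0 => h1 0 le_rfl h0 (by simpa using h0), fun x hx => ?_⟩
  rcases lt_or_gt_of_ne hx with hx | hx
  · have h3 := h1 (-x) (by omega)
    have h4 := h2 (-x) (by omega)
    rw [neg_neg] at h3 h4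
    tauto
  · have h3 := h1 x hx.le
    have h4 := h2 x hx
    tauto

theorem mem_principal_of_doubled {mu : YoungDiagram} (h : mu ∈ doubledDistinct) (k : ℕ) :
    k ∈ mu.principalHookLengths ↔ ∃ x : ℤ, 0 ≤ x ∧ x ∈ mu.betaSet ∧ (k : ℤ) = 2 * x := by
  simp only [principalHookLengths, Finset.mem_image, Finset.mem_filter, mem_cells]
  constructor
  · rintro ⟨⟨i, j⟩, ⟨hm, hij⟩, rfl⟩
    obtain rfl : i = j := hij
    have h1 := mu.hookLength_add hm
    have h2 := mem_iff_lt_rowLen.1 hm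
    have h3 := colLen_of_doubled h hm
    exact ⟨_, by omega, ⟨i, rfl⟩, by omega⟩
  · rintro ⟨_, hx, ⟨i, rfl⟩, hk⟩
    have hm : (i, i) ∈ mu := mem_iff_lt_rowLen.2 (by omega)
    have h1 := mu.hookLength_add hm
    have h3 := colLen_of_doubled h hm
    exact ⟨(i, i), ⟨hm, rfl⟩, by omega⟩

/-! ### From sets of integers back to diagrams -/

/-- A nonincreasing counting function with steps `0` and `1` and balanced tails is the counting
function of the beta set of a Young diagram. -/
theorem exists_of_count (N : ℤ → ℕ) (K : ℕ) (hstep : ∀ z, N z = N (z + 1) ∨ N z = N (z + 1) + 1)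
    (htop : ∀ z, (K : ℤ) ≤ z → N z = 0) (hbot : ∀ k : ℕ, K ≤ k → N (-k) = k) :
    ∃ la : YoungDiagram, (∀ i j : ℕ, (i, j) ∈ la ↔ i < N (j - i)) ∧
      ∀ x, x ∈ la.betaSet ↔ N x = N (x + 1) + 1 := by
  have hanti : Antitone N := antitone_int_of_succ_le fun z => by have := hstep z; omega
  have hmono : Monotone fun z => (N z : ℤ) + z := monotone_int_of_le_succ fun z => by
    have := hstep z
    omega
  have hge : ∀ z, 0 ≤ (N z : ℤ) + z := fun z => by
    have h1 := hmono (show -((K + z.natAbs : ℕ) : ℤ) ≤ z by omega)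
    have h2 := hbot (K + z.natAbs) (by omega)
    simp only [h2] at h1
    omega
  have hfin : ∀ i j : ℕ, i < N (j - i) → i < K ∧ j < 2 * K := by
    intro i j hij
    have h1 : i < K := by
      by_contra hi
      rcases le_or_gt (K + j) i with h | h
      · have := hbot (i - j) (by omega)
        rw [show (-((i - j : ℕ) : ℤ)) = j - i by omega] at this
        omega
      · have := hanti (show -(K : ℤ) ≤ j - i by omega)
        have := hbot K le_rfl
        omega
    refine ⟨h1, ?_⟩
    by_contra hj
    have := htop (j - i) (by omega)
    omega
  -- Box `(i, j)` must be present when the `i`-th largest element (from `0`) is at least `j - i`,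
  -- that is, when more than `i` elements are. Monotonicity of `N` allows moving left, that of `N z
  -- + z` moving up; `hfin` makes the truncation harmless.
  let la : YoungDiagram :=
    { cells := (Finset.range K ×ˢ Finset.range (2 * K)).filter
        (fun c : ℕ × ℕ => c.1 < N ((c.2 : ℤ) - c.1))
      isLowerSet := by
        rintro ⟨a, b⟩ ⟨c, d⟩ hle hab
        obtain ⟨hca, hdb⟩ : c ≤ a ∧ d ≤ b := hle
        simp only [Finset.coe_filter, Finset.mem_product, Finset.mem_range,
          Set.mem_ofPred_eq] at hab ⊢
        refine ⟨⟨by omega, by omega⟩, ?_⟩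
        have h1 := hanti (show (d : ℤ) - a ≤ b - a by omega)
        have h2 := hmono (show (d : ℤ) - a ≤ d - c by omega)
        simp only at h2
        omega }
  have hmem : ∀ i j : ℕ, (i, j) ∈ la ↔ i < N (j - i) := fun i j => by
    rw [← mem_cells]
    simp only [la, Finset.mem_filter, Finset.mem_product, Finset.mem_range]
    exact ⟨fun h => h.2, fun h => ⟨hfin i j h, h⟩⟩
  refine ⟨la, hmem, fun x => ⟨?_, fun hx => ?_⟩⟩
  · rintro ⟨i, rfl⟩
    have h1 := hmem i (la.rowLen i)
    rw [mem_iff_lt_rowLen] at h1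
    have h2 := hstep ((la.rowLen i : ℤ) - i - 1)
    rw [sub_add_cancel] at h2 ⊢
    rcases Nat.eq_zero_or_pos (la.rowLen i) with h0 | h0
    · have := hge ((la.rowLen i : ℤ) - i - 1)
      omega
    · have h3 := hmem i (la.rowLen i - 1)
      rw [mem_iff_lt_rowLen, show ((la.rowLen i - 1 : ℕ) : ℤ) - i = la.rowLen i - i - 1 by omega]
        at h3
      omega
  -- The row of `x` is the number of elements larger than `x`.
  · refine ⟨N (x + 1), ?_⟩
    have hx0 := hge x
    have key : ∀ j : ℕ, j < la.rowLen (N (x + 1)) ↔ (j : ℤ) < x + N (x + 1) + 1 := fun j => by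
      rw [← mem_iff_lt_rowLen, hmem]
      constructor
      · intro h
        by_contra hlt
        have := hanti (show x + 1 ≤ (j : ℤ) - N (x + 1) by omega)
        omega
      · intro h
        have := hanti (show (j : ℤ) - N (x + 1) ≤ x by omega)
        omega
    have h1 := key (la.rowLen (N (x + 1)))
    have h2 := key (x + N (x + 1) + 1).toNat
    omega

end YoungDiagram
namespace YoungDiagram

theorem ncard_inter_Ici {B : Set ℤ} {K : ℕ} (hB : ∀ x ∈ B, x < K) (z : ℤ) :
    (z ∈ B → (B ∩ Set.Ici z).ncard = (B ∩ Set.Ici (z + 1)).ncard + 1) ∧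
      (z ∉ B → (B ∩ Set.Ici z).ncard = (B ∩ Set.Ici (z + 1)).ncard) := by
  have hfin : (B ∩ Set.Ici (z + 1)).Finite :=
    (Set.finite_Ico (z + 1) (K : ℤ)).subset fun x hx => ⟨hx.2, hB x hx.1⟩
  constructor
  · intro hz
    rw [← Set.ncard_insert_of_notMem (a := z) (by simp) hfin]
    congr 1
    ext x
    simp only [Set.mem_inter_iff, Set.mem_Ici, Set.mem_insert_iff]
    constructor
    · rintro ⟨hx, hzx⟩
      rcases hzx.eq_or_lt with h | h
      · exact Or.inl h.symm
      · exact Or.inr ⟨hx, h⟩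
    · rintro (rfl | ⟨hx, hzx⟩)
      · exact ⟨hz, le_rfl⟩
      · exact ⟨hx, by omega⟩
  · intro hz
    congr 1
    ext x
    simp only [Set.mem_inter_iff, Set.mem_Ici]
    refine and_congr_right fun hx => ⟨fun h => ?_, fun h => by omega⟩
    rcases h.eq_or_lt with h | h
    · exact absurd (h ▸ hx) hz
    · exact h

theorem ncard_inter_Ici_eq_zero {B : Set ℤ} {K : ℕ} (hB : ∀ x ∈ B, x < K) {z : ℤ}
    (hz : (K : ℤ) ≤ z) : (B ∩ Set.Ici z).ncard = 0 := by
  have : B ∩ Set.Ici z = ∅ := by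
    ext x
    simp only [Set.mem_inter_iff, Set.mem_Ici, Set.mem_empty_iff_false, iff_false, not_and]
    intro hx
    have := hB x hx
    omega
  rw [this, Set.ncard_empty]

theorem exists_of_balanced {B : Set ℤ} {K : ℕ} (hB : ∀ x ∈ B, x < K)
    (hbot : ∀ k : ℕ, K ≤ k → (B ∩ Set.Ici (-(k : ℤ))).ncard = k) :
    ∃ la : YoungDiagram, (∀ i j : ℕ, (i, j) ∈ la ↔ i < (B ∩ Set.Ici ((j : ℤ) - i)).ncard) ∧
      la.betaSet = B := by
  obtain ⟨la, h1, h2⟩ := exists_of_count (fun z => (B ∩ Set.Ici z).ncard) K (fun z => by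
      have := ncard_inter_Ici hB z
      tauto) (fun z hz => ncard_inter_Ici_eq_zero hB hz) hbot
  refine ⟨la, h1, Set.ext fun x => (h2 x).trans ?_⟩
  have := ncard_inter_Ici hB x
  by_cases hx : x ∈ B
  · simp [hx, this.1 hx]
  · simp [hx, this.2 hx]

/-- The reflection gives `N (-d) = N d + d` for the counting function. This one identity provides
both the balanced tail and the invariance of `i < N (j - i)` under swapping `i` and `j`. -/
theorem exists_transpose_eq_of_betaSet {B : Set ℤ} {K : ℕ} (hB : ∀ x ∈ B, x < K)
    (hs : ∀ x, x ∈ B ↔ -1 - x ∉ B) : ∃ la : YoungDiagram, la.transpose = la ∧ la.betaSet = B := by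
  have hN : ∀ d : ℕ, (B ∩ Set.Ici (-(d : ℤ))).ncard = (B ∩ Set.Ici (d : ℤ)).ncard + d := by
    intro d
    induction d with
    | zero => simp
    | succ d ih =>
      have h1 := ncard_inter_Ici hB d
      have h2 := ncard_inter_Ici hB (-1 - d)
      rw [show (-1 - (d : ℤ)) + 1 = -d by ring] at h2
      have h3 := hs d
      push_cast
      rw [show -((d : ℤ) + 1) = -1 - d by ring]
      by_cases hd : (d : ℤ) ∈ B
      · rw [h2.2 (h3.1 hd), ih, h1.1 hd]
        ring
      · rw [h2.1 (by tauto), ih, h1.2 hd]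
        ring
  obtain ⟨la, hla, hb⟩ := exists_of_balanced hB fun k hk => by
    rw [hN, ncard_inter_Ici_eq_zero hB (by omega), zero_add]
  refine ⟨la, YoungDiagram.ext (Finset.ext fun ⟨i, j⟩ => ?_), hb⟩
  rw [mem_cells, mem_cells, mem_transpose, Prod.swap_prod_mk, hla, hla]
  rcases le_total i j with h | h
  · have := hN (j - i)
    rw [Nat.cast_sub h, neg_sub] at this
    omega
  · have := hN (i - j)
    rw [Nat.cast_sub h, neg_sub] at this
    omega

/-- Here the reflection gives `N (-d) = N (d + 1) + d`; the extra `1` is the column shift in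
`mem_doubledDistinct_iff`. -/
theorem exists_doubled_of_betaSet {B : Set ℤ} {K : ℕ} (hB : ∀ x ∈ B, x < K) (h0 : 0 ∉ B)
    (hs : ∀ x, x ≠ 0 → (x ∈ B ↔ -x ∉ B)) : ∃ mu ∈ doubledDistinct, mu.betaSet = B := by
  have hN : ∀ d : ℕ, (B ∩ Set.Ici (-(d : ℤ))).ncard = (B ∩ Set.Ici ((d : ℤ) + 1)).ncard + d := by
    intro d
    induction d with
    | zero => simpa using (ncard_inter_Ici hB 0).2 h0
    | succ d ih =>
      have h1 := ncard_inter_Ici hB (d + 1)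
      have h2 := ncard_inter_Ici hB (-(d + 1))
      rw [show (-((d : ℤ) + 1)) + 1 = -d by ring] at h2
      have h3 := hs (d + 1) (by omega)
      push_cast
      by_cases hd : (d : ℤ) + 1 ∈ B
      · rw [h2.2 (h3.1 hd), ih, h1.1 hd]
        ring
      · rw [h2.1 (by tauto), ih, h1.2 hd]
        ring
  obtain ⟨mu, hmu, hb⟩ := exists_of_balanced hB fun k hk => by
    rw [hN, ncard_inter_Ici_eq_zero hB (by omega), zero_add]
  refine ⟨mu, mem_doubledDistinct_iff.2 fun a c hac => ?_, hb⟩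
  have := hN (c - a)
  rw [Nat.cast_sub hac, neg_sub] at this
  rw [hmu, hmu, show ((c + 1 : ℕ) : ℤ) - a = c - a + 1 by push_cast; ring]
  omega

/-! ### Merging a pair into one symmetric set -/

/-- The union of the beta set of `la`, moved to the odd integers, and that of `mu`, moved to the
even integers. -/
def pairSet (la mu : YoungDiagram) : Set ℤ :=
  {z | ∃ x, (x ∈ la.betaSet ∧ z = 2 * x + 1) ∨ (x ∈ mu.betaSet ∧ z = 2 * x)}

theorem odd_mem_pairSet {la mu : YoungDiagram} {x : ℤ} :
    2 * x + 1 ∈ pairSet la mu ↔ x ∈ la.betaSet := by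
  constructor
  · rintro ⟨y, ⟨hy, h⟩ | ⟨hy, h⟩⟩
    · rwa [show x = y by omega]
    · omega
  · exact fun h => ⟨x, Or.inl ⟨h, rfl⟩⟩

theorem even_mem_pairSet {la mu : YoungDiagram} {x : ℤ} :
    2 * x ∈ pairSet la mu ↔ x ∈ mu.betaSet := by
  constructor
  · rintro ⟨y, ⟨hy, h⟩ | ⟨hy, h⟩⟩
    · omega
    · rwa [show x = y by omega]
  · exact fun h => ⟨x, Or.inr ⟨h, rfl⟩⟩

end YoungDiagram

/-- Sets of integers that are closed under subtraction of `2 * m` and contain exactly one of `x`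
and `-x` for every `x ≠ 0`, and not `0`. -/
structure IsSymmetricCoreSet (m : ℕ) (T : Set ℤ) : Prop where
  zero_notMem : 0 ∉ T
  neg_mem_iff : ∀ x, x ≠ 0 → (x ∈ T ↔ -x ∉ T)
  sub_mem : ∀ x ∈ T, x - 2 * m ∈ T
  bdd : ∃ K : ℕ, ∀ x ∈ T, x < K

namespace YoungDiagram

/-- After doubling, the reflections `x ↦ -1 - x` on odd and `x ↦ -x` on even integers both become
negation, and the shift by `m` becomes a shift by `2 * m`. -/
theorem isSymmetricCoreSet_pairSet {m : ℕ} (hm : 0 < m) {la mu : YoungDiagram}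
    (hla : la ∈ selfConjugateCores m) (hmu : mu ∈ doubledDistinctCores m) :
    IsSymmetricCoreSet m (pairSet la mu) := by
  have hs := betaSet_symm_of_transpose_eq hla.1
  obtain ⟨h0, hd⟩ := betaSet_symm_of_doubled hmu.1
  refine ⟨fun h => h0 (even_mem_pairSet (x := 0) |>.1 (by simpa using h)), fun x hx => ?_, ?_, ?_⟩
  · obtain ⟨y, rfl | rfl⟩ := Int.even_or_odd' x
    · rw [even_mem_pairSet, ← mul_neg, even_mem_pairSet]
      exact hd y (by omega)
    · rw [odd_mem_pairSet, show -(2 * y + 1) = 2 * (-1 - y) + 1 by ring, odd_mem_pairSet]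
      exact hs y
  · intro x hx
    obtain ⟨y, rfl | rfl⟩ := Int.even_or_odd' x
    · rw [even_mem_pairSet] at hx
      rw [← mul_sub, even_mem_pairSet]
      exact (isCore_iff hm).1 hmu.2 y hx
    · rw [odd_mem_pairSet] at hx
      rw [show 2 * y + 1 - 2 * (m : ℤ) = 2 * (y - m) + 1 by ring, odd_mem_pairSet]
      exact (isCore_iff hm).1 hla.2 y hx
  · refine ⟨2 * la.rowLen 0 + 2 * mu.rowLen 0 + 1, fun x hx => ?_⟩
    rcases hx with ⟨y, ⟨hy, rfl⟩ | ⟨hy, rfl⟩⟩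
    · have := betaSet_lt _ hy
      push_cast
      omega
    · have := betaSet_lt _ hy
      push_cast
      omega

theorem exists_pairSet_eq {m : ℕ} (hm : 0 < m) {T : Set ℤ} (hT : IsSymmetricCoreSet m T) :
    ∃ la ∈ selfConjugateCores m, ∃ mu ∈ doubledDistinctCores m, pairSet la mu = T := by
  obtain ⟨K, hK⟩ := hT.bdd
  obtain ⟨la, hla, hb⟩ := exists_transpose_eq_of_betaSet (B := {x | 2 * x + 1 ∈ T}) (K := K)
    (fun x hx => by have := hK _ hx; omega) (fun x => by
      have := hT.neg_mem_iff (2 * x + 1) (by omega)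
      rwa [show -(2 * x + 1) = 2 * (-1 - x) + 1 by ring] at this)
  obtain ⟨mu, hmu, hb'⟩ := exists_doubled_of_betaSet (B := {x | 2 * x ∈ T}) (K := K)
    (fun x hx => by have := hK _ hx; omega) (by simpa using hT.zero_notMem) (fun x hx => by
      have := hT.neg_mem_iff (2 * x) (by omega)
      rwa [← mul_neg] at this)
  refine ⟨la, ⟨hla, (isCore_iff hm).2 fun x hx => ?_⟩, mu, ⟨hmu, (isCore_iff hm).2 fun x hx => ?_⟩,
    Set.ext fun x => ?_⟩
  · rw [hb] at hx ⊢
    have := hT.sub_mem _ hx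
    rwa [show 2 * x + 1 - 2 * (m : ℤ) = 2 * (x - m) + 1 by ring] at this
  · rw [hb'] at hx ⊢
    have := hT.sub_mem _ hx
    rwa [← mul_sub] at this
  · obtain ⟨y, rfl | rfl⟩ := Int.even_or_odd' x
    · rw [even_mem_pairSet, hb']
      rfl
    · rw [odd_mem_pairSet, hb]
      rfl

theorem pairSet_inj {la la' mu mu' : YoungDiagram} (h : pairSet la mu = pairSet la' mu') :
    la = la' ∧ mu = mu' := by
  constructor
  · refine betaSet_injective (Set.ext fun x => ?_)
    rw [← odd_mem_pairSet (mu := mu), h, odd_mem_pairSet]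
  · refine betaSet_injective (Set.ext fun x => ?_)
    rw [← even_mem_pairSet (la := la), h, even_mem_pairSet]

theorem mem_principal_union {m : ℕ} {la mu : YoungDiagram}
    (hla : la ∈ selfConjugateCores m) (hmu : mu ∈ doubledDistinctCores m) (k : ℕ) :
    k ∈ la.principalHookLengths ∪ mu.principalHookLengths ↔ (k : ℤ) ∈ pairSet la mu := by
  rw [Finset.mem_union, mem_principal_of_transpose_eq hla.1, mem_principal_of_doubled hmu.1]
  constructor
  · rintro (⟨x, -, hx, h⟩ | ⟨x, -, hx, h⟩)
    · exact ⟨x, Or.inl ⟨hx, h⟩⟩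
    · exact ⟨x, Or.inr ⟨hx, h⟩⟩
  · rintro ⟨x, ⟨hx, h⟩ | ⟨hx, h⟩⟩
    · exact Or.inl ⟨x, by omega, hx, h⟩
    · exact Or.inr ⟨x, by omega, hx, h⟩

/-- Principal hook lengths are odd for `la` and even for `mu`, so the union is disjoint. -/
theorem card_add_card {m : ℕ} {la mu : YoungDiagram}
    (hla : la ∈ selfConjugateCores m) (hmu : mu ∈ doubledDistinctCores m) :
    la.card + mu.card = ∑ h ∈ la.principalHookLengths ∪ mu.principalHookLengths, h := by
  rw [Finset.sum_union, ← card_eq_sum_principal, ← card_eq_sum_principal]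
  rw [Finset.disjoint_left]
  intro k hk hk'
  rw [mem_principal_of_transpose_eq hla.1] at hk
  rw [mem_principal_of_doubled hmu.1] at hk'
  obtain ⟨x, -, -, hx⟩ := hk
  obtain ⟨y, -, -, hy⟩ := hk'
  omega

end YoungDiagram

/-! ### Residue classes and thresholds -/

namespace IsSymmetricCoreSet

variable {m : ℕ} {T : Set ℤ}

theorem sub_mul_mem (hT : IsSymmetricCoreSet m T) {x : ℤ} (hx : x ∈ T) (k : ℕ) :
    x - 2 * m * k ∈ T := by
  induction k with
  | zero => simpa using hx
  | succ k ih =>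
    have := hT.sub_mem _ ih
    convert this using 1
    push_cast
    ring

theorem mem_of_le (hT : IsSymmetricCoreSet m T) {r q q' : ℤ} (hq : 2 * m * q + r - m ∈ T)
    (h : q' ≤ q) : 2 * m * q' + r - m ∈ T := by
  obtain ⟨k, rfl⟩ := Int.le.dest h
  have := hT.sub_mul_mem hq k
  convert this using 1
  ring

/-- This class contains both `m` and `-m`, which differ by `2 * m`: having `m` in `T` would force
`-m` in as well, so `-m` is in and `m` is out. -/
theorem mem_zero_residue_iff (hT : IsSymmetricCoreSet m T) (hm : 0 < m) (q : ℤ) :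
    2 * m * q + 0 - m ∈ T ↔ q ≤ 0 := by
  have h1 : (m : ℤ) ∉ T := fun h => by
    have h2 := hT.sub_mem _ h
    rw [show (m : ℤ) - 2 * m = -m by ring] at h2
    exact (hT.neg_mem_iff m (by omega)).1 h h2
  have h2 : 2 * (m : ℤ) * 0 + 0 - m ∈ T := by
    have := hT.neg_mem_iff m (by omega)
    simpa using not_not.1 fun h => h1 (this.2 (by simpa using h))
  refine ⟨fun h => ?_, hT.mem_of_le h2⟩
  by_contra hq
  have h3 := hT.mem_of_le h (show 1 ≤ q by omega)
  rw [show 2 * (m : ℤ) * 1 + 0 - m = m by ring] at h3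
  exact h1 h3

theorem mem_middle_residue_iff (hT : IsSymmetricCoreSet m T) (hm : 0 < m) (q : ℤ) :
    2 * m * q + m - m ∈ T ↔ q < 0 := by
  have h0 : ∀ p : ℤ, 0 ≤ p → 2 * m * p + m - m ∉ T := fun p hp h => by
    have := hT.mem_of_le h hp
    exact hT.zero_notMem (by simpa using this)
  refine ⟨fun h => not_le.1 fun hq => h0 q hq h, fun hq => ?_⟩
  have h1 := h0 (-q) (by omega)
  have hne : 2 * (m : ℤ) * q + m - m ≠ 0 := by
    rw [add_sub_cancel_right]
    exact mul_ne_zero (by omega) hq.ne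
  rw [hT.neg_mem_iff _ hne]
  convert h1 using 2
  ring

/-- Membership of the residue class `-r - m` is governed by that of `r - m`. -/
theorem mem_neg_residue_iff (hT : IsSymmetricCoreSet m T) {r : ℤ} (h0 : 0 < r) (hr : r < m)
    (q : ℤ) : 2 * m * q - r - m ∈ T ↔ 2 * m * (1 - q) + r - m ∉ T := by
  have hne : 2 * (m : ℤ) * q - r - m ≠ 0 := by
    intro h
    have hd : 2 * (m : ℤ) ∣ r + m := ⟨q, by linarith⟩
    have := Int.le_of_dvd (by omega) hd
    omega
  rw [hT.neg_mem_iff _ hne, show -(2 * (m : ℤ) * q - r - m) = 2 * m * (1 - q) + r - m by ring]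

theorem eq_of_residues {T' : Set ℤ} (hT : IsSymmetricCoreSet m T) (hT' : IsSymmetricCoreSet m T')
    (hm : 0 < m)
    (h : ∀ r : ℤ, 0 < r → r < m → ∀ q, 2 * m * q + r - m ∈ T ↔ 2 * m * q + r - m ∈ T') :
    T = T' := by
  ext x
  have hx := Int.mul_ediv_add_emod (x + m) (2 * m)
  have h1 := Int.emod_nonneg (x + m) (show 2 * (m : ℤ) ≠ 0 by omega)
  have h2 := Int.emod_lt_of_pos (x + m) (show 0 < 2 * (m : ℤ) by omega)
  generalize (x + m) / (2 * m) = q at *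
  generalize (x + m) % (2 * m) = r at *
  obtain rfl : x = 2 * m * q + r - m := by linarith
  rcases h1.eq_or_lt with rfl | h1
  · rw [hT.mem_zero_residue_iff hm, hT'.mem_zero_residue_iff hm]
  rcases lt_trichotomy r m with h3 | rfl | h3
  · exact h r h1 h3 q
  · rw [hT.mem_middle_residue_iff hm, hT'.mem_middle_residue_iff hm]
  -- A residue above `m` is the negative of `2 * m - r < m`, with the quotient raised by one.
  · rw [show 2 * (m : ℤ) * q + r - m = 2 * m * (q + 1) - (2 * m - r) - m by ring,
      hT.mem_neg_residue_iff (by omega) (by omega), hT'.mem_neg_residue_iff (by omega) (by omega),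
      h _ (by omega) (by omega)]

theorem exists_threshold (hT : IsSymmetricCoreSet m T) (hm : 0 < m) (r : ℤ) (hr : 0 ≤ r) :
    ∃ n : ℤ, ∀ q, 2 * m * q + r - m ∈ T ↔ q ≤ n := by
  obtain ⟨K, hK⟩ := hT.bdd
  have hpos : 0 < 2 * (m : ℤ) := by omega
  obtain ⟨n, hn, hmax⟩ := Int.exists_greatest_of_bdd (P := fun q => 2 * m * q + r - m ∈ T)
    ⟨K + m, fun q hq => by
      have h1 := hK _ hq
      by_contra hlt
      have : q ≤ 2 * m * q := le_mul_of_one_le_left (by omega) (by omega)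
      omega⟩
    -- The quotient is low enough for the negated element to exceed the bound `K`; the symmetry then
    -- puts the element itself in `T`.
    ⟨-(K + r), by
      have h1 : (K : ℤ) + r ≤ 2 * m * (K + r) := le_mul_of_one_le_left (by omega) (by omega)
      have h2 : -(2 * m * -(K + r) + r - m) ∉ T := fun h => by
        have h3 := hK _ h
        have h4 : 2 * (K + r) ≤ 2 * m * ((K : ℤ) + r) :=
          mul_le_mul_of_nonneg_right (by omega) (by omega)
        rw [mul_neg] at h3
        omega
      refine (hT.neg_mem_iff _ ?_).2 h2
      have h4 : 2 * (K + r) ≤ 2 * m * ((K : ℤ) + r) :=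
        mul_le_mul_of_nonneg_right (by omega) (by omega)
      rw [mul_neg]
      omega⟩
  exact ⟨n, fun q => ⟨hmax q, hT.mem_of_le hn⟩⟩

end IsSymmetricCoreSet

/-- `n i` is the largest `q` with `2 * (t + 1) * q + (i + 1) - (t + 1) ∈ T`, for every `i`. -/
def IsThreshold (t : ℕ) (T : Set ℤ) (n : Fin t → ℤ) : Prop :=
  ∀ (i : Fin t) (q : ℤ), 2 * ((t + 1 : ℕ) : ℤ) * q + ((i : ℕ) + 1 : ℤ) - (t + 1 : ℕ) ∈ T ↔ q ≤ n i

theorem IsThreshold.unique {t : ℕ} {T : Set ℤ} {n n' : Fin t → ℤ} (h : IsThreshold t T n)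
    (h' : IsThreshold t T n') : n = n' :=
  funext fun i => eq_of_forall_le_iff fun q => (h i q).symm.trans (h' i q)

theorem IsSymmetricCoreSet.exists_isThreshold {t : ℕ} {T : Set ℤ}
    (hT : IsSymmetricCoreSet (t + 1) T) : ∃ n, IsThreshold t T n := by
  choose n hn using fun i : Fin t => hT.exists_threshold t.succ_pos ((i : ℕ) + 1) (by omega)
  exact ⟨n, hn⟩

theorem IsSymmetricCoreSet.eq_of_isThreshold {t : ℕ} {T T' : Set ℤ} {n : Fin t → ℤ}
    (hT : IsSymmetricCoreSet (t + 1) T) (hT' : IsSymmetricCoreSet (t + 1) T')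
    (h : IsThreshold t T n) (h' : IsThreshold t T' n) : T = T' := by
  refine hT.eq_of_residues hT' t.succ_pos fun r h0 hr q => ?_
  have hr' : (((r - 1).toNat : ℕ) : ℤ) + 1 = r := by omega
  have h1 := (h ⟨(r - 1).toNat, by omega⟩ q).trans (h' ⟨(r - 1).toNat, by omega⟩ q).symm
  rwa [Fin.val_mk, hr'] at h1

/-! ### Symmetric core sets with prescribed thresholds -/

/-- The largest quotient by `2 * t + 2` allowed on the residue class `r`. -/
def residueBound {t : ℕ} (n : Fin t → ℤ) (r : ℤ) : ℤ :=
  if r = 0 then 0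
  else if h : 0 < r ∧ r < t + 1 then n ⟨(r - 1).toNat, by omega⟩
  -- With `i = 2 * t + 2 - r`, the condition on the class `-i` is `q + 1 ≤ -n_i`, because the
  -- quotient shifts by one.
  else if h : t + 1 < r ∧ r < 2 * t + 2 then -1 - n ⟨(2 * t + 1 - r).toNat, by omega⟩
  -- On residues in range this is the case `r = t + 1`, the multiples of `2 * t + 2`: only the
  -- negative ones belong.
  else -1

theorem residueBound_neg {t : ℕ} (n : Fin t → ℤ) {r : ℤ} (h0 : 0 < r) (hr : r < 2 * t + 2)
    (hne : r ≠ t + 1) : residueBound n (2 * t + 2 - r) = -1 - residueBound n r := by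
  rcases lt_or_gt_of_ne hne with h | h
  · rw [residueBound, if_neg (by omega), dif_neg (by omega), dif_pos (by omega), residueBound,
      if_neg (by omega), dif_pos (by omega)]
    congr 4
    omega
  · rw [residueBound, if_neg (by omega), dif_pos (by omega), residueBound,
      if_neg (by omega), dif_neg (by omega), dif_pos (by omega), sub_sub_cancel]
    congr 3
    omega

theorem residueBound_le {t : ℕ} (n : Fin t → ℤ) (r : ℤ) : residueBound n r ≤ ∑ i, |n i| := by
  have h1 : ∀ i, |n i| ≤ ∑ i, |n i| := fun i =>
    Finset.single_le_sum (f := fun i => |n i|) (fun i _ => abs_nonneg _) (Finset.mem_univ i)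
  have h0 : 0 ≤ ∑ i, |n i| := Finset.sum_nonneg fun i _ => abs_nonneg _
  unfold residueBound
  split_ifs with _ h h
  · exact h0
  · exact (le_abs_self _).trans (h1 _)
  · have := h1 ⟨(2 * t + 1 - r).toNat, by omega⟩
    have := neg_abs_le (n ⟨(2 * t + 1 - r).toNat, by omega⟩)
    omega
  · omega

/-- The set of integers with the prescribed bounds on the residue classes modulo `2 * t + 2`. -/
def thresholdSet {t : ℕ} (n : Fin t → ℤ) : Set ℤ :=
  {x | (x + (t + 1)) / (2 * t + 2) ≤ residueBound n ((x + (t + 1)) % (2 * t + 2))}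

theorem mem_thresholdSet {t : ℕ} (n : Fin t → ℤ) {q r : ℤ} (h0 : 0 ≤ r) (hr : r < 2 * t + 2) :
    (2 * t + 2) * q + r - (t + 1) ∈ thresholdSet n ↔ q ≤ residueBound n r := by
  have h1 : ((2 * (t : ℤ) + 2) * q + r) / (2 * t + 2) = q := by
    rw [Int.add_comm, Int.add_mul_ediv_left _ _ (by omega), Int.ediv_eq_zero_of_lt h0 hr, zero_add]
  have h2 : ((2 * (t : ℤ) + 2) * q + r) % (2 * t + 2) = r := by
    rw [Int.add_comm, Int.add_mul_emod_self_left, Int.emod_eq_of_lt h0 hr]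
  change (_ : ℤ) ≤ _ ↔ _
  rw [sub_add_cancel, h1, h2]

theorem isSymmetricCoreSet_thresholdSet {t : ℕ} (n : Fin t → ℤ) :
    IsSymmetricCoreSet (t + 1) (thresholdSet n) := by
  have hrep : ∀ x : ℤ, ∃ q r : ℤ, 0 ≤ r ∧ r < 2 * t + 2 ∧ x = (2 * t + 2) * q + r - (t + 1) :=
    fun x => ⟨(x + (t + 1)) / (2 * t + 2), _,
      Int.emod_nonneg (x + (t + 1)) (show 2 * (t : ℤ) + 2 ≠ 0 by omega),
      Int.emod_lt_of_pos (x + (t + 1)) (show 0 < 2 * (t : ℤ) + 2 by omega), by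
      have := Int.mul_ediv_add_emod (x + (t + 1)) (2 * t + 2)
      linarith⟩
  have hzero : residueBound n 0 = 0 := if_pos rfl
  have hmid : residueBound n (t + 1) = -1 := by
    rw [residueBound, if_neg (by omega), dif_neg (by omega), dif_neg (by omega)]
  refine ⟨?_, fun x hx => ?_, fun x hx => ?_, ?_⟩
  · rw [show (0 : ℤ) = (2 * t + 2) * 0 + (t + 1) - (t + 1) by ring,
      mem_thresholdSet n (by omega) (by omega), hmid]
    omega
  · obtain ⟨q, r, h0, hr, rfl⟩ := hrep x
    rw [mem_thresholdSet n h0 hr]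
    rcases h0.eq_or_lt with rfl | h0
    · rw [show -((2 * (t : ℤ) + 2) * q + 0 - (t + 1)) = (2 * t + 2) * (1 - q) + 0 - (t + 1) by ring,
        mem_thresholdSet n le_rfl hr, hzero]
      omega
    · rw [show -((2 * (t : ℤ) + 2) * q + r - (t + 1)) =
        (2 * t + 2) * (-q) + (2 * t + 2 - r) - (t + 1) by ring,
        mem_thresholdSet n (by omega) (by omega)]
      by_cases hne : r = t + 1
      · subst hne
        rw [show 2 * (t : ℤ) + 2 - (t + 1) = t + 1 by ring, hmid]
        have : q ≠ 0 := by
          rintro rfl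
          exact hx (by ring)
        omega
      · rw [residueBound_neg n h0 hr hne]
        omega
  · obtain ⟨q, r, h0, hr, rfl⟩ := hrep x
    rw [mem_thresholdSet n h0 hr] at hx
    rw [show (2 * (t : ℤ) + 2) * q + r - (t + 1) - 2 * ((t + 1 : ℕ) : ℤ) =
      (2 * t + 2) * (q - 1) + r - (t + 1) by push_cast; ring, mem_thresholdSet n h0 hr]
    omega
  · refine ⟨((2 * t + 2) * (∑ i, |n i|) + (2 * t + 2)).toNat, fun x hx => ?_⟩
    obtain ⟨q, r, h0, hr, rfl⟩ := hrep x
    rw [mem_thresholdSet n h0 hr] at hx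
    have h1 := mul_le_mul_of_nonneg_left (hx.trans (residueBound_le n r))
      (show 0 ≤ 2 * (t : ℤ) + 2 by omega)
    refine lt_of_lt_of_le ?_ (Int.self_le_toNat _)
    linarith

theorem isThreshold_thresholdSet {t : ℕ} (n : Fin t → ℤ) : IsThreshold t (thresholdSet n) n := by
  intro i q
  have hi := i.2
  rw [show 2 * ((t + 1 : ℕ) : ℤ) * q + ((i : ℕ) + 1 : ℤ) - (t + 1 : ℕ) =
    (2 * t + 2) * q + ((i : ℕ) + 1 : ℤ) - (t + 1) by push_cast; ring,
    mem_thresholdSet n (by omega) (by omega), residueBound, if_neg (by omega), dif_pos (by omega)]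
  simp

/-! ### Nonnegative elements: their sum and maxima -/

theorem nonneg_residue_iff {m r q : ℤ} (h0 : -m < r) (hr : r < m) :
    0 ≤ 2 * m * q + r - m ↔ 1 ≤ q := by
  constructor
  · intro h
    by_contra hq
    have := mul_nonneg (show 0 ≤ 2 * m by omega) (show 0 ≤ -q by omega)
    rw [mul_neg] at this
    omega
  · intro h
    have := mul_le_mul_of_nonneg_left h (show 0 ≤ 2 * m by omega)
    omega

/-- The nonnegative elements `2 * m * q ± r - m` of a symmetric core set with threshold `n`. -/
noncomputable def residuePart (m r n : ℤ) : Finset ℤ :=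
  (Finset.Icc 1 n).image (fun q => 2 * m * q + r - m) ∪
    (Finset.Icc 1 (-n)).image (fun q => 2 * m * q - r - m)

theorem mem_residuePart {m r n z : ℤ} : z ∈ residuePart m r n ↔
    (∃ q, (1 ≤ q ∧ q ≤ n) ∧ 2 * m * q + r - m = z) ∨
      ∃ q, (1 ≤ q ∧ q ≤ -n) ∧ 2 * m * q - r - m = z := by
  simp only [residuePart, Finset.mem_union, Finset.mem_image, Finset.mem_Icc]

/-- Both `r - r'` and `r + r'` have absolute value below `2 * m`, so divisibility makes them vanish;
for the sum this contradicts positivity. -/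
theorem residue_unique {m r r' q q' : ℤ} (h0 : 0 < r) (hr : r < m) (h0' : 0 < r') (hr' : r' < m)
    (h : 2 * m * q + r = 2 * m * q' + r' ∨ 2 * m * q + r = 2 * m * q' - r') : r = r' := by
  rcases h with h | h
  · have := Int.eq_zero_of_abs_lt_dvd (m := 2 * m) (x := r - r') ⟨q' - q, by linarith⟩
      (abs_lt.2 ⟨by omega, by omega⟩)
    omega
  · have := Int.eq_zero_of_abs_lt_dvd (m := 2 * m) (x := r + r') ⟨q' - q, by linarith⟩
      (abs_lt.2 ⟨by omega, by omega⟩)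
    omega

theorem disjoint_residuePart {m r r' : ℤ} (n n' : ℤ) (h0 : 0 < r) (hr : r < m) (h0' : 0 < r')
    (hr' : r' < m) (hne : r ≠ r') : Disjoint (residuePart m r n) (residuePart m r' n') := by
  rw [Finset.disjoint_left]
  intro z hz hz'
  rw [mem_residuePart] at hz hz'
  rcases hz with ⟨q, -, rfl⟩ | ⟨q, -, rfl⟩ <;> rcases hz' with ⟨q', -, h⟩ | ⟨q', -, h⟩
  · exact hne (residue_unique (q := q) (q' := q') h0 hr h0' hr' (Or.inl (by linarith)))
  · exact hne (residue_unique (q := q) (q' := q') h0 hr h0' hr' (Or.inr (by linarith)))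
  · exact hne (residue_unique (q := q') (q' := q) h0' hr' h0 hr (Or.inr (by linarith))).symm
  · exact hne (residue_unique (q := -q) (q' := -q') h0 hr h0' hr' (Or.inl (by linarith)))

theorem sum_Icc_residue {m : ℤ} (hm : 0 < m) (r : ℤ) (N : ℕ) :
    ∑ z ∈ (Finset.Icc 1 (N : ℤ)).image (fun q => 2 * m * q + r - m), z = m * N ^ 2 + r * N := by
  rw [Finset.sum_image fun a _ b _ hab => by
    have : 2 * m * a = 2 * m * b := by linarith
    exact mul_left_cancel₀ (by omega) this]
  induction N with
  | zero => simp
  | succ N ih =>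
    have : Finset.Icc 1 ((N + 1 : ℕ) : ℤ) = insert ((N : ℤ) + 1) (Finset.Icc 1 (N : ℤ)) := by
      ext x
      simp only [Finset.mem_insert, Finset.mem_Icc]
      omega
    rw [this, Finset.sum_insert (by simp), ih]
    push_cast
    ring

/-- At most one of the two progressions is nonempty, and they are exchanged by `(r, n) ↦ (-r, -n)`,
which preserves the value. -/
theorem sum_residuePart {m : ℤ} (hm : 0 < m) (r n : ℤ) :
    ∑ z ∈ residuePart m r n, z = m * n ^ 2 + r * n := by
  obtain ⟨N, rfl | rfl⟩ := n.eq_nat_or_neg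
  · rw [residuePart, Finset.Icc_eq_empty (a := 1) (b := -(N : ℤ)) (by omega), Finset.image_empty,
      Finset.union_empty, sum_Icc_residue hm]
  · have := sum_Icc_residue hm (-r) N
    simp only [← sub_eq_add_neg] at this
    rw [residuePart, Finset.Icc_eq_empty (a := 1) (b := -(N : ℤ)) (by omega), Finset.image_empty,
      Finset.empty_union, neg_neg, this]
    ring

/-- The two forced classes contribute only negative elements. In the others, nonnegativity means `1
≤ q`, and the upper bound is `n i` or, by reflection, `-n i`. -/
theorem nonneg_mem_iff_exists_residuePart {t : ℕ} {T : Set ℤ} {n : Fin t → ℤ}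
    (hT : IsSymmetricCoreSet (t + 1) T) (hn : IsThreshold t T n) (z : ℤ) :
    0 ≤ z ∧ z ∈ T ↔ ∃ i : Fin t, z ∈ residuePart ((t + 1 : ℕ) : ℤ) ((i : ℕ) + 1) (n i) := by
  have hm : 0 < t + 1 := t.succ_pos
  have hneg : ∀ (i : Fin t) (q : ℤ),
      2 * ((t + 1 : ℕ) : ℤ) * q - ((i : ℕ) + 1 : ℤ) - (t + 1 : ℕ) ∈ T ↔ q ≤ -n i := fun i q => by
    have hi := i.2
    rw [hT.mem_neg_residue_iff (by omega) (by omega), hn]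
    omega
  have hpos : ∀ (i : Fin t) (q : ℤ),
      0 ≤ 2 * ((t + 1 : ℕ) : ℤ) * q + ((i : ℕ) + 1 : ℤ) - (t + 1 : ℕ) ↔ 1 ≤ q := fun i q => by
    have hi := i.2
    exact nonneg_residue_iff (by omega) (by omega)
  have hpos' : ∀ (i : Fin t) (q : ℤ),
      0 ≤ 2 * ((t + 1 : ℕ) : ℤ) * q - ((i : ℕ) + 1 : ℤ) - (t + 1 : ℕ) ↔ 1 ≤ q := fun i q => by
    have hi := i.2
    rw [sub_eq_add_neg (2 * ((t + 1 : ℕ) : ℤ) * q)]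
    exact nonneg_residue_iff (by omega) (by omega)
  constructor
  · rintro ⟨hz0, hz⟩
    have hx := Int.mul_ediv_add_emod (z + (t + 1 : ℕ)) (2 * (t + 1 : ℕ))
    have h1 := Int.emod_nonneg (z + (t + 1 : ℕ)) (show 2 * ((t + 1 : ℕ) : ℤ) ≠ 0 by omega)
    have h2 := Int.emod_lt_of_pos (z + (t + 1 : ℕ)) (show 0 < 2 * ((t + 1 : ℕ) : ℤ) by omega)
    generalize (z + (t + 1 : ℕ)) / (2 * (t + 1 : ℕ)) = q at *
    generalize (z + (t + 1 : ℕ)) % (2 * (t + 1 : ℕ)) = r at *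
    obtain rfl : z = 2 * (t + 1 : ℕ) * q + r - (t + 1 : ℕ) := by linarith
    rcases h1.eq_or_lt with rfl | h1
    · rw [hT.mem_zero_residue_iff hm] at hz
      rw [nonneg_residue_iff (by omega) (by omega)] at hz0
      omega
    rcases lt_trichotomy r (t + 1 : ℕ) with h3 | rfl | h3
    · have hr' : (((r - 1).toNat : ℕ) : ℤ) + 1 = r := by omega
      have h4 := hn ⟨(r - 1).toNat, by omega⟩ q
      have h5 := hpos ⟨(r - 1).toNat, by omega⟩ q
      rw [Fin.val_mk, hr'] at h4 h5
      refine ⟨⟨(r - 1).toNat, by omega⟩, mem_residuePart.2 (Or.inl ⟨q, ⟨h5.1 hz0, h4.1 hz⟩, ?_⟩)⟩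
      rw [Fin.val_mk, hr']
    · rw [hT.mem_middle_residue_iff hm] at hz
      have := mul_nonneg (show 0 ≤ 2 * ((t + 1 : ℕ) : ℤ) by omega) (show 0 ≤ -q - 1 by omega)
      rw [mul_sub, mul_neg] at this
      omega
    · have hr' : (((2 * t + 1 - r).toNat : ℕ) : ℤ) + 1 = 2 * (t + 1 : ℕ) - r := by omega
      have h4 := hneg ⟨(2 * t + 1 - r).toNat, by omega⟩ (q + 1)
      have h5 := hpos' ⟨(2 * t + 1 - r).toNat, by omega⟩ (q + 1)
      have he : 2 * ((t + 1 : ℕ) : ℤ) * (q + 1) - (2 * (t + 1 : ℕ) - r) - (t + 1 : ℕ) =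
        2 * (t + 1 : ℕ) * q + r - (t + 1 : ℕ) := by ring
      rw [Fin.val_mk, hr', he] at h4 h5
      refine ⟨⟨(2 * t + 1 - r).toNat, by omega⟩,
        mem_residuePart.2 (Or.inr ⟨q + 1, ⟨h5.1 hz0, h4.1 hz⟩, ?_⟩)⟩
      rw [Fin.val_mk, hr', he]
  · rintro ⟨i, hi⟩
    rcases mem_residuePart.1 hi with ⟨q, ⟨h1, h2⟩, rfl⟩ | ⟨q, ⟨h1, h2⟩, rfl⟩
    · exact ⟨(hpos i q).2 h1, (hn i q).2 h2⟩
    · exact ⟨(hpos' i q).2 h1, (hneg i q).2 h2⟩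

theorem sum_eq_of_isThreshold {t : ℕ} {T : Set ℤ} {n : Fin t → ℤ}
    (hT : IsSymmetricCoreSet (t + 1) T) (hn : IsThreshold t T n) {U : Finset ℕ}
    (hU : ∀ k : ℕ, k ∈ U ↔ (k : ℤ) ∈ T) :
    ((∑ h ∈ U, h : ℕ) : ℤ) =
      ((t : ℤ) + 1) * ∑ i : Fin t, n i ^ 2 + ∑ i : Fin t, ((i : ℕ) + 1 : ℤ) * n i := by
  have hUnion : U.image (fun k : ℕ => (k : ℤ)) =
      Finset.univ.biUnion fun i : Fin t => residuePart ((t + 1 : ℕ) : ℤ) ((i : ℕ) + 1) (n i) := by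
    ext z
    simp only [Finset.mem_biUnion, Finset.mem_univ, true_and, Finset.mem_image]
    rw [← nonneg_mem_iff_exists_residuePart hT hn]
    constructor
    · rintro ⟨k, hk, rfl⟩
      exact ⟨by omega, (hU k).1 hk⟩
    · rintro ⟨h0, hz⟩
      lift z to ℕ using h0
      exact ⟨z, (hU z).2 hz, rfl⟩
  rw [Nat.cast_sum, ← Finset.sum_image (f := fun z : ℤ => z) (g := fun k : ℕ => (k : ℤ))
    (fun a _ b _ h => Nat.cast_injective h), hUnion, Finset.sum_biUnion]
  · rw [Finset.mul_sum, ← Finset.sum_add_distrib]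
    refine Finset.sum_congr rfl fun i _ => ?_
    rw [sum_residuePart (by omega)]
    push_cast
    ring
  · intro i _ j _ hij
    have := i.2
    have := j.2
    have := Fin.val_ne_of_ne hij
    exact disjoint_residuePart _ _ (by omega) (by omega) (by omega) (by omega) (by omega)

theorem YoungDiagram.maxHook_eq_of_isThreshold {t : ℕ} {T : Set ℤ} {n : Fin t → ℤ}
    (hT : IsSymmetricCoreSet (t + 1) T) (hn : IsThreshold t T n) {la mu : YoungDiagram}
    (hU : ∀ k : ℕ, k ∈ la.principalHookLengths ∪ mu.principalHookLengths ↔ (k : ℤ) ∈ T)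
    (i : Fin t) :
    (t : ℤ) + 1 + maxHook t la mu ((i : ℕ) + 1) =
      signOf (n i) * ((2 * (t : ℤ) + 2) * n i + ((i : ℕ) + 1 : ℤ)) := by
  have hi := i.2
  -- Indices start at `0` here, so the default `i - t - 1` reads `i - t`. It is the `q = 0` term of
  -- the class and is negative, hence it is the maximum only when `n i = 0`.
  have hmem : ∀ z : ℤ, z ∈ hookClass t la mu ((i : ℕ) + 1) ↔ z = (i : ℤ) - t ∨
      z ∈ residuePart ((t + 1 : ℕ) : ℤ) ((i : ℕ) + 1) (n i) := by
    intro z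
    rw [hookClass, Finset.mem_insert, Finset.mem_filter, Finset.mem_image]
    push_cast
    refine or_congr (by rw [add_sub_right_comm, add_sub_cancel_right]) ⟨?_, fun hz => ?_⟩
    · rintro ⟨⟨k, hk, rfl⟩, hmod⟩
      obtain ⟨j, hj⟩ := (nonneg_mem_iff_exists_residuePart hT hn k).1 ⟨by omega, (hU k).1 hk⟩
      have hj' := j.2
      suffices ((j : ℕ) : ℤ) + 1 = (i : ℕ) + 1 by
        obtain rfl : j = i := Fin.ext (by omega)
        exact_mod_cast hj
      rw [Int.modEq_iff_dvd, Int.modEq_iff_dvd] at hmod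
      rcases mem_residuePart.1 hj with ⟨q, -, hq⟩ | ⟨q, -, hq⟩ <;> push_cast at hq <;>
        rcases hmod with ⟨p, hp⟩ | ⟨p, hp⟩
      · exact residue_unique (m := t + 1) (q := q) (q' := -p) (by omega) (by omega) (by omega)
          (by omega) (Or.inl (by linarith))
      · exact residue_unique (m := t + 1) (q := q) (q' := -p) (by omega) (by omega) (by omega)
          (by omega) (Or.inr (by linarith))
      · exact residue_unique (m := t + 1) (q := -q) (q' := p) (by omega) (by omega) (by omega)
          (by omega) (Or.inr (by linarith))
      · exact residue_unique (m := t + 1) (q := -q) (q' := p) (by omega) (by omega) (by omega)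
          (by omega) (Or.inl (by linarith))
    · have hz' := (nonneg_mem_iff_exists_residuePart hT hn z).2 ⟨i, by exact_mod_cast hz⟩
      refine ⟨⟨z.toNat, (hU _).2 (by rw [Int.toNat_of_nonneg hz'.1]; exact hz'.2),
        Int.toNat_of_nonneg hz'.1⟩, ?_⟩
      rw [Int.modEq_iff_dvd, Int.modEq_iff_dvd]
      rcases mem_residuePart.1 hz with ⟨q, -, rfl⟩ | ⟨q, -, rfl⟩
      · exact Or.inl ⟨-q, by ring⟩
      · exact Or.inr ⟨-q, by ring⟩
  have hmax : maxHook t la mu ((i : ℕ) + 1) =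
      signOf (n i) * ((2 * (t : ℤ) + 2) * n i + ((i : ℕ) + 1 : ℤ)) - (t + 1) := by
    unfold signOf
    have h2t : 0 ≤ 2 * (t : ℤ) + 2 := by omega
    refine le_antisymm (Finset.max'_le _ _ _ fun z hz => ?_) (Finset.le_max' _ _ ((hmem _).2 ?_))
    · rcases (hmem z).1 hz with rfl | hz
      · split_ifs with h
        · have := mul_nonneg h2t h
          linarith
        · have := mul_nonneg h2t (show 0 ≤ -n i - 1 by omega)
          linarith
      · rcases mem_residuePart.1 hz with ⟨q, ⟨h1, h2⟩, rfl⟩ | ⟨q, ⟨h1, h2⟩, rfl⟩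
        · have := mul_le_mul_of_nonneg_left h2 h2t
          rw [if_pos (by omega)]
          push_cast
          linarith
        · have := mul_le_mul_of_nonneg_left h2 h2t
          rw [if_neg (by omega)]
          push_cast
          linarith
    · rcases lt_trichotomy (n i) 0 with h | h | h
      · refine Or.inr (mem_residuePart.2 (Or.inr ⟨-n i, by omega, ?_⟩))
        rw [if_neg (by omega)]
        push_cast
        ring
      · left
        rw [h, if_pos le_rfl]
        ring
      · refine Or.inr (mem_residuePart.2 (Or.inl ⟨n i, by omega, ?_⟩))
        rw [if_pos h.le]
        push_cast
        ring
  rw [hmax]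
  ring

/-! ### The bijection -/

theorem mainTheorem3 (t : ℕ) (ht : 2 ≤ t) :
    ∃ φ : YoungDiagram.selfConjugateCores (t + 1) × YoungDiagram.doubledDistinctCores (t + 1) ≃
        (Fin t → ℤ),
      ∀ (la : YoungDiagram.selfConjugateCores (t + 1))
        (mu : YoungDiagram.doubledDistinctCores (t + 1)),
        ((la.1.card : ℤ) + (mu.1.card : ℤ) =
          ((t : ℤ) + 1) * ∑ i : Fin t, (φ (la, mu) i) ^ 2 +
            ∑ i : Fin t, ((i : ℕ) + 1 : ℤ) * φ (la, mu) i) ∧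
        ∀ i : Fin t,
          (t : ℤ) + 1 + YoungDiagram.maxHook t la.1 mu.1 ((i : ℕ) + 1) =
            signOf (φ (la, mu) i) *
              ((2 * (t : ℤ) + 2) * φ (la, mu) i + ((i : ℕ) + 1 : ℤ)) := by
  have hT := fun p : YoungDiagram.selfConjugateCores (t + 1) ×
      YoungDiagram.doubledDistinctCores (t + 1) =>
    YoungDiagram.isSymmetricCoreSet_pairSet t.succ_pos p.1.2 p.2.2
  -- The bijection sends a pair to the thresholds of its merged set.
  choose f hf using fun p => (hT p).exists_isThreshold
  have hbij : Function.Bijective f := by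
    constructor
    · intro p p' h
      have hf' := hf p'
      rw [← h] at hf'
      have := YoungDiagram.pairSet_inj ((hT p).eq_of_isThreshold (hT p') (hf p) hf')
      exact Prod.ext (Subtype.ext this.1) (Subtype.ext this.2)
    · intro n
      obtain ⟨la, hla, mu, hmu, h⟩ := YoungDiagram.exists_pairSet_eq t.succ_pos
        (isSymmetricCoreSet_thresholdSet n)
      have hf' := hf (⟨la, hla⟩, ⟨mu, hmu⟩)
      rw [h] at hf'
      exact ⟨_, hf'.unique (isThreshold_thresholdSet n)⟩
  refine ⟨Equiv.ofBijective f hbij, fun la mu => ?_⟩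
  have hU := YoungDiagram.mem_principal_union la.2 mu.2
  rw [Equiv.ofBijective_apply]
  refine ⟨?_, YoungDiagram.maxHook_eq_of_isThreshold (hT (la, mu)) (hf (la, mu)) hU⟩
  rw [← sum_eq_of_isThreshold (hT (la, mu)) (hf (la, mu)) hU,
    ← YoungDiagram.card_add_card la.2 mu.2, Nat.cast_add]
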